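/- For a set $A$ of positive integers and an integer $n\ge 0$, let $N^p_A(n)$ denote the total number of parts, counted with multiplicity, in all partitions of $n$ whose parts all belong to $A$ (so $N^p_A(0)=0$). Let $A=\{a_1,\dots,a_k\}$ be a finite set of $k$ distinct positive integers with $\gcd(a_1,\dots,a_k)=1$. Then, as $n\to\infty$, $$N^p_A(n)\sim\frac{1}{k!}\cdot\frac{\frac1{a_1}+\frac1{a_2}+\cdots+\frac1{a_k}}{a_1a_2\cdots a_k}\,n^k,$$ that is, the ratio of the two sides tends to $1$. Moreover, for every $r\in\{0,1,\dots,a_1a_2\cdots a_k-1\}$ there is a polynomial $Q_r$ with rational coefficients, of degree exactly $k$ and with leading coefficient $$\frac{1}{k!}\sum_{i=1}^{k}a_i^{k-2}\prod_{\substack{1\le j\le k\\ j\ne i}}a_j^{k-1},$$ such that $N^p_A(a_1a_2\cdots a_k\,l+r)=Q_r(l)$ for every integer $l\ge 0$. -/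

import Mathlib

/-- The number of parts function of a set `A` of positive integers: the total number of parts,
counted with multiplicity, in all the partitions of `n` whose parts all belong to `A`. -/
def numParts (A : Set ℕ) [DecidablePred (· ∈ A)] (n : ℕ) : ℕ :=
  ∑ p ∈ Nat.Partition.restricted n (· ∈ A), p.parts.card

/-! Let k = |A|, let D be the product of A, and write P(x) for the product of 1/(1 - x^b) over b in
A. Marking one part gives the generating function (∑ x^a/(1 - x^a)) P(x), which over a common
denominator is N(x)/(1 - x^D)^(k+1) with deg N < D(k+1) (`mk_numParts_mul_eq_numPartsNumerator`).
Its coefficient at Dl + r is the sum of N_i · C(l + k - i/D, k) over i ≡ r mod D, a polynomial in l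
whose l^k coefficient is (∑ N_i)/k!. Because the gcd is 1, 1 + x + ... + x^(D-1) divides N
(`geom_sum_dvd_prod_geomQuot`), so these class sums all equal N(1)/D > 0
(`residueSum_numPartsNumerator`). Hence the degree is exactly k, the leading coefficient does not
depend on r, and the asymptotics on the D classes glue together. -/

/-! ### Coefficient sums over residue classes -/

open Polynomial in
/-- The sum of the coefficients of a polynomial over a residue class of exponents. -/
noncomputable def residueSum (D r : ℕ) : ℚ[X] →ₗ[ℚ] ℚ :=
  Polynomial.lsum fun i => if i % D = r then LinearMap.id else 0

open Polynomial in
theorem residueSum_eq_sum_range {D r K : ℕ} {p : ℚ[X]} (h : p.natDegree < K) :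
    residueSum D r p = ∑ i ∈ Finset.range K, if i % D = r then p.coeff i else 0 := by
  rw [residueSum, Polynomial.lsum_apply, Polynomial.sum_over_range' _ _ K h]
  · exact Finset.sum_congr rfl fun i _ => by split_ifs <;> simp
  · intro n; exact map_zero _

theorem sum_range_ite_add_mod {D r : ℕ} (hr : r < D) (j : ℕ) (c : ℚ) :
    (∑ i ∈ Finset.range D, if (i + j) % D = r then c else 0) = c := by
  have hj : j % D < D := Nat.mod_lt _ (by omega)
  have key : ∀ i < D, ((i + j) % D = r ↔ i = (r + (D - j % D)) % D) := by
    intro i hi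
    rw [Nat.add_mod i j D, Nat.mod_eq_of_lt hi]
    have h1 : (i + j % D) % D = if i + j % D < D then i + j % D else i + j % D - D := by
      split_ifs with h
      · exact Nat.mod_eq_of_lt h
      · rw [Nat.mod_eq_sub_mod (by omega), Nat.mod_eq_of_lt (by omega)]
    have h2 : (r + (D - j % D)) % D =
        if r + (D - j % D) < D then r + (D - j % D) else r + (D - j % D) - D := by
      split_ifs with h
      · exact Nat.mod_eq_of_lt h
      · rw [Nat.mod_eq_sub_mod (by omega), Nat.mod_eq_of_lt (by omega)]
    rw [h1, h2]
    split_ifs <;> omega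
  rw [Finset.sum_congr rfl fun i hi => by rw [if_congr (key i (Finset.mem_range.1 hi)) rfl rfl],
    Finset.sum_ite_eq' (Finset.range D), if_pos]
  exact Finset.mem_range.2 (Nat.mod_lt _ (by omega))

-- The geometric factor spreads each monomial of `M` once over every residue class, so each class
-- collects all the coefficients of `M`.
open Polynomial in
theorem residueSum_geom_mul {D r : ℕ} (hr : r < D) (M : ℚ[X]) :
    residueSum D r ((∑ i ∈ Finset.range D, X ^ i) * M) = M.eval 1 := by
  induction M using Polynomial.induction_on' with
  | add p q hp hq => rw [mul_add, map_add, hp, hq, eval_add]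
  | monomial n c =>
    rw [Finset.sum_mul, map_sum, eval_monomial, one_pow, mul_one]
    refine Eq.trans ?_ (sum_range_ite_add_mod hr n c)
    refine Finset.sum_congr rfl fun i _ => ?_
    rw [X_pow_mul_monomial, residueSum, Polynomial.lsum_apply, Polynomial.sum_monomial_index]
    · rw [add_comm n i]; split_ifs <;> simp
    · exact map_zero _

/-! ### The numerator and its divisibility -/

open Polynomial in
/-- The quotient of `1 - X ^ D` by `1 - X ^ a`, for `a` dividing `D`. -/
noncomputable def geomQuot (D a : ℕ) : ℚ[X] := ∑ j ∈ Finset.range (D / a), (X ^ a) ^ j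

open Polynomial in
theorem geomQuot_mul_sub_one {D a : ℕ} (h : a ∣ D) :
    geomQuot D a * (X ^ a - 1) = X ^ D - 1 := by
  rw [geomQuot, geom_sum_mul, ← pow_mul, Nat.mul_div_cancel' h]

open Polynomial in
theorem natDegree_geomQuot_le {D a : ℕ} (h : a ∣ D) : (geomQuot D a).natDegree ≤ D - a := by
  refine natDegree_sum_le_of_forall_le _ _ fun j hj => ?_
  rw [← pow_mul, natDegree_X_pow]
  obtain ⟨c, rfl⟩ := h
  rcases Nat.eq_zero_or_pos a with rfl | ha
  · simp
  rw [Finset.mem_range, Nat.mul_div_cancel_left _ ha] at hj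
  calc a * j ≤ a * (c - 1) := Nat.mul_le_mul_left _ (by omega)
    _ = a * c - a := by rw [Nat.mul_sub, mul_one]

open Polynomial in
theorem eval_one_geomQuot {D a : ℕ} (h : a ∣ D) (ha : a ≠ 0) :
    (geomQuot D a).eval 1 = (D : ℚ) / a := by
  rw [geomQuot, eval_finsetSum]
  simp [Nat.cast_div h (Nat.cast_ne_zero.2 ha)]

theorem mem_closure_of_gcd_eq_one {A : Finset ℕ} (hgcd : A.gcd id = 1) :
    ∃ n, ∀ m ≥ n, m ∈ AddSubmonoid.closure (A : Set ℕ) := by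
  obtain ⟨n, hn⟩ := Nat.exists_mem_closure_of_ge (A : Set ℕ)
  refine ⟨n, fun m hm => hn m hm ?_⟩
  have : Nat.setGcd (A : Set ℕ) ∣ A.gcd id :=
    Finset.dvd_gcd fun a ha => Nat.setGcd_dvd_of_mem ha
  rw [hgcd] at this
  exact this.trans (one_dvd _)

-- The exponents n for which X^D - 1 divides (X^n - 1)P form an additive monoid containing `A`. As
-- the gcd is 1, it contains two consecutive integers, which yields n = 1; then X - 1 cancels.
open Polynomial in
theorem geom_sum_dvd_prod_geomQuot {A : Finset ℕ} {D : ℕ} (hD : 0 < D) (hdvd : ∀ a ∈ A, a ∣ D)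
    (hgcd : A.gcd id = 1) :
    (∑ i ∈ Finset.range D, (X : ℚ[X]) ^ i) ∣ ∏ a ∈ A, geomQuot D a := by
  set P := ∏ a ∈ A, geomQuot D a with hP
  have key : ∀ n ∈ AddSubmonoid.closure (A : Set ℕ), (X : ℚ[X]) ^ D - 1 ∣ (X ^ n - 1) * P := by
    intro n hn
    induction hn using AddSubmonoid.closure_induction with
    | mem a ha =>
      rw [hP, ← Finset.mul_prod_erase A _ ha, ← mul_assoc, mul_comm (X ^ a - 1),
        geomQuot_mul_sub_one (hdvd a ha)]
      exact dvd_mul_right _ _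
    | zero => simp
    | add m n _ _ hm hn =>
      have : ((X : ℚ[X]) ^ (m + n) - 1) * P = X ^ m * ((X ^ n - 1) * P) + (X ^ m - 1) * P := by
        ring
      rw [this]
      exact dvd_add (dvd_mul_of_dvd_right hn _) hm
  obtain ⟨n, hn⟩ := mem_closure_of_gcd_eq_one hgcd
  have h1 := key (D * n + 1) (hn _ (by nlinarith))
  have h2 := key (D * n) (hn _ (by nlinarith))
  have h3 : (X : ℚ[X]) ^ D - 1 ∣ (X - 1) * P := by
    have : ((X : ℚ[X]) - 1) * P =
        (X ^ (D * n + 1) - 1) * P - X * ((X ^ (D * n) - 1) * P) := by ring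
    rw [this]
    exact dvd_sub h1 (dvd_mul_of_dvd_right h2 _)
  rw [← geom_sum_mul, mul_comm] at h3
  exact (mul_dvd_mul_iff_left (X_sub_C_ne_zero (1 : ℚ))).1 (by simpa using h3)

open Polynomial in
/-- The numerator of the generating function of `numParts A` over `(1 - X ^ D) ^ (A.card + 1)`. -/
noncomputable def numPartsNumerator (A : Finset ℕ) (D : ℕ) : ℚ[X] :=
  (∑ a ∈ A, X ^ a * geomQuot D a) * ∏ b ∈ A, geomQuot D b

theorem natDegree_numPartsNumerator_lt {A : Finset ℕ} {D : ℕ} (hD : 0 < D)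
    (hpos : ∀ a ∈ A, 0 < a) (hdvd : ∀ a ∈ A, a ∣ D) (hA : A.Nonempty) :
    (numPartsNumerator A D).natDegree < D * (A.card + 1) := by
  have h1 : (∑ a ∈ A, Polynomial.X ^ a * geomQuot D a).natDegree ≤ D := by
    refine Polynomial.natDegree_sum_le_of_forall_le _ _ fun a ha => ?_
    refine Polynomial.natDegree_mul_le.trans ?_
    rw [Polynomial.natDegree_X_pow]
    have := natDegree_geomQuot_le (hdvd a ha)
    have := Nat.le_of_dvd hD (hdvd a ha)
    omega
  have h2 : (∏ b ∈ A, geomQuot D b).natDegree < D * A.card := by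
    refine (Polynomial.natDegree_prod_le _ _).trans_lt ?_
    rw [mul_comm, ← smul_eq_mul, ← Finset.sum_const]
    refine Finset.sum_lt_sum_of_nonempty hA fun a ha => ?_
    have := natDegree_geomQuot_le (hdvd a ha)
    have := hpos a ha
    omega
  calc (numPartsNumerator A D).natDegree ≤ _ := Polynomial.natDegree_mul_le
    _ < D + D * A.card := add_lt_add_of_le_of_lt h1 h2
    _ = D * (A.card + 1) := by ring

theorem residueSum_numPartsNumerator {A : Finset ℕ} {D r : ℕ} (hr : r < D)
    (hpos : ∀ a ∈ A, 0 < a) (hdvd : ∀ a ∈ A, a ∣ D) (hgcd : A.gcd id = 1) :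
    residueSum D r (numPartsNumerator A D) =
      (∑ a ∈ A, 1 / (a : ℚ)) * ∏ b ∈ A, (D : ℚ) / b := by
  have hD : 0 < D := by omega
  obtain ⟨M, hM⟩ := geom_sum_dvd_prod_geomQuot hD hdvd hgcd
  have hN : numPartsNumerator A D = (∑ i ∈ Finset.range D, (Polynomial.X) ^ i) *
      ((∑ a ∈ A, Polynomial.X ^ a * geomQuot D a) * M) := by
    rw [numPartsNumerator, hM]; ring
  have hM1 : (∏ b ∈ A, (D : ℚ) / b) = D * M.eval 1 := by
    have := congrArg (Polynomial.eval 1) hM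
    rw [Polynomial.eval_prod, Polynomial.eval_mul, Polynomial.eval_finsetSum] at this
    calc (∏ b ∈ A, (D : ℚ) / b) = ∏ b ∈ A, (geomQuot D b).eval 1 :=
          Finset.prod_congr rfl fun b hb =>
            (eval_one_geomQuot (hdvd b hb) (hpos b hb).ne').symm
      _ = D * M.eval 1 := by rw [this]; simp
  rw [hN, residueSum_geom_mul hr, Polynomial.eval_mul, Polynomial.eval_finsetSum, hM1,
    ← mul_assoc, Finset.sum_mul _ _ (D : ℚ)]
  congr 1
  refine Finset.sum_congr rfl fun a ha => ?_
  rw [Polynomial.eval_mul, eval_one_geomQuot (hdvd a ha) (hpos a ha).ne']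
  simp; ring

/-! ### The generating function as an Euler product -/

/-- The power series `∑ w j X ^ (a * j)`. -/
noncomputable def dilatedSeries (a : ℕ) (w : ℕ → ℚ) : PowerSeries ℚ :=
  PowerSeries.mk fun n => if a ∣ n then w (n / a) else 0

theorem dilatedSeries_eq_expand {a : ℕ} (ha : a ≠ 0) (w : ℕ → ℚ) :
    dilatedSeries a w = PowerSeries.expand a ha (PowerSeries.mk w) := by
  ext n
  simp [dilatedSeries, PowerSeries.coeff_expand]

open scoped PowerSeries.WithPiTopology in
theorem one_add_tsum_eq_dilatedSeries {a : ℕ} (ha : a ≠ 0) {w : ℕ → ℚ} (hw : w 0 = 1) :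
    1 + ∑' j, w (j + 1) • (PowerSeries.X : PowerSeries ℚ) ^ (a * (j + 1)) = dilatedSeries a w := by
  ext n
  have hs := Nat.Partition.summable_genFun_term' (fun _ c => w c) ha
  rw [map_add, hs.map_tsum _ (PowerSeries.WithPiTopology.continuous_coeff _ _), dilatedSeries,
    PowerSeries.coeff_mk]
  simp only [map_smul, PowerSeries.coeff_X_pow, PowerSeries.coeff_one, smul_eq_mul]
  split_ifs with h0 h h
  · subst h0
    simp [hw, ha]
  · subst h0; simp at h
  · obtain ⟨m, rfl⟩ := h
    obtain ⟨m, rfl⟩ : ∃ j, m = j + 1 := Nat.exists_eq_succ_of_ne_zero (by rintro rfl; simp at h0)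
    rw [tsum_eq_single m]
    · simp [Nat.pos_of_ne_zero ha]
    · intro j hj
      simp [ha, hj.symm]
  · rw [zero_add]
    convert! tsum_zero with j
    rw [if_neg, mul_zero]
    rintro rfl
    exact h (dvd_mul_right _ _)

open scoped PowerSeries.WithPiTopology in
theorem genFun_ite_mem_eq_prod {A : Finset ℕ} (hpos : ∀ a ∈ A, 0 < a) {w : ℕ → ℕ → ℚ}
    (hw : ∀ a ∈ A, w a 0 = 1) :
    Nat.Partition.genFun (fun i c => if i ∈ A then w i c else 0) =
      ∏ a ∈ A, dilatedSeries a (w a) := by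
  rw [Nat.Partition.genFun_eq_tprod]
  -- The infinite product is indexed by i ↦ part i + 1, hence the shift.
  have hinj : Set.InjOn (fun a : ℕ => a - 1) A := by
    intro a ha b hb h
    have := hpos a ha
    have := hpos b hb
    simp only at h
    omega
  rw [tprod_eq_prod (s := A.image (fun a => a - 1)), Finset.prod_image hinj]
  · refine Finset.prod_congr rfl fun a ha => ?_
    have h1 : a - 1 + 1 = a := Nat.sub_add_cancel (hpos a ha)
    simp only [h1, if_pos ha]
    exact one_add_tsum_eq_dilatedSeries (hpos a ha).ne' (hw a ha)
  · intro i hi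
    have : i + 1 ∉ A := fun h => hi (Finset.mem_image.2 ⟨i + 1, h, by simp⟩)
    simp [this]

theorem card_parts_eq_sum_count {A : Finset ℕ} {n : ℕ} (p : n.Partition)
    (hp : ∀ i ∈ p.parts, i ∈ A) : p.parts.card = ∑ a ∈ A, p.parts.count a :=
  (Multiset.sum_count_eq_card hp).symm

theorem toFinsupp_prod_ite_mem {A : Finset ℕ} {n : ℕ} (p : n.Partition) {w : ℕ → ℕ → ℚ}
    (hw : ∀ a ∈ A, w a 0 = 1) :
    p.parts.toFinsupp.prod (fun i c => if i ∈ A then w i c else 0) =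
      if ∀ i ∈ p.parts, i ∈ A then ∏ a ∈ A, w a (p.parts.count a) else 0 := by
  rw [Finsupp.prod]
  split_ifs with h
  · simp only [Multiset.toFinsupp_support, Multiset.toFinsupp_apply]
    refine Finset.prod_subset_one_on_sdiff (fun i hi => h i (by simpa using hi)) ?_ ?_
    · intro a ha
      rw [Finset.mem_sdiff, Multiset.mem_toFinset] at ha
      rw [Multiset.count_eq_zero_of_notMem ha.2, hw a ha.1]
    · intro i hi
      rw [if_pos (h i (by simpa using hi))]
  · push Not at h
    obtain ⟨i, hi, hiA⟩ := h
    exact Finset.prod_eq_zero (i := i) (by simpa using hi) (if_neg hiA)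

/-- The multiplicity c of a is written as (c + 1) - 1, since the product formula needs weights equal
to 1 at c = 0. -/
theorem mk_numParts_eq {A : Finset ℕ} (hpos : ∀ a ∈ A, 0 < a) :
    (PowerSeries.mk fun n => (numParts (A : Set ℕ) n : ℚ)) =
      ∑ a ∈ A, (∏ b ∈ A, dilatedSeries b (fun c => if b = a then (c : ℚ) + 1 else 1) -
        ∏ b ∈ A, dilatedSeries b fun _ => 1) := by
  ext n
  rw [map_sum, PowerSeries.coeff_mk, numParts, Nat.cast_sum, Nat.Partition.restricted,
    Finset.sum_filter]
  have h1 : ∀ a ∈ A, PowerSeries.coeff n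
      (∏ b ∈ A, dilatedSeries b (fun c => if b = a then (c : ℚ) + 1 else 1) -
        ∏ b ∈ A, dilatedSeries b fun _ => 1) =
      ∑ p : n.Partition, if ∀ i ∈ p.parts, i ∈ A then (p.parts.count a : ℚ) else 0 := by
    intro a ha
    rw [← genFun_ite_mem_eq_prod (w := fun b c => if b = a then (c : ℚ) + 1 else 1) hpos
      (by simp), ← genFun_ite_mem_eq_prod (w := fun _ _ => 1) hpos (by simp), map_sub,
      Nat.Partition.coeff_genFun, Nat.Partition.coeff_genFun, ← Finset.sum_sub_distrib]
    refine Finset.sum_congr rfl fun p _ => ?_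
    rw [toFinsupp_prod_ite_mem p (w := fun b c => if b = a then (c : ℚ) + 1 else 1) (by simp),
      toFinsupp_prod_ite_mem p (w := fun _ _ => 1) (by simp)]
    split_ifs
    · simp [Finset.prod_ite_eq', ha]
    · simp
  rw [Finset.sum_congr rfl h1, Finset.sum_comm]
  refine Finset.sum_congr rfl fun p _ => ?_
  by_cases h : ∀ i ∈ p.parts, i ∈ A
  · simp only [Finset.mem_coe, if_pos h]
    rw [card_parts_eq_sum_count p h, Nat.cast_sum]
  · simp [if_neg h]

theorem dilatedSeries_mul_one_sub_pow {a : ℕ} (ha : a ≠ 0) (d : ℕ) :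
    dilatedSeries a (fun n => ((d + n).choose d : ℚ)) * (1 - PowerSeries.X ^ a) ^ (d + 1) = 1 := by
  have := congrArg (PowerSeries.expand a ha)
    (PowerSeries.mk_add_choose_mul_one_sub_pow_eq_one ℚ d)
  simpa [dilatedSeries_eq_expand ha] using this

theorem dilatedSeries_one_mul {a : ℕ} (ha : a ≠ 0) :
    dilatedSeries a (fun _ => 1) * (1 - PowerSeries.X ^ a) = 1 := by
  simpa using dilatedSeries_mul_one_sub_pow ha 0

theorem dilatedSeries_succ {a : ℕ} (ha : a ≠ 0) :
    dilatedSeries a (fun c => (c : ℚ) + 1) =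
      dilatedSeries a (fun _ => 1) * dilatedSeries a fun _ => 1 := by
  have h1 := dilatedSeries_one_mul ha
  have h2 : dilatedSeries a (fun c => (c : ℚ) + 1) * (1 - PowerSeries.X ^ a) ^ 2 = 1 := by
    simpa [add_comm] using dilatedSeries_mul_one_sub_pow ha 1
  set G := dilatedSeries a (fun _ => 1)
  set H := dilatedSeries a (fun c => (c : ℚ) + 1)
  calc H = H * (G * (1 - PowerSeries.X ^ a)) * (G * (1 - PowerSeries.X ^ a)) := by simp [h1]
    _ = (H * (1 - PowerSeries.X ^ a) ^ 2) * (G * G) := by ring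
    _ = G * G := by rw [h2, one_mul]

theorem dilatedSeries_one_mul_eq_geomQuot {a D : ℕ} (ha : a ≠ 0) (h : a ∣ D) :
    dilatedSeries a (fun _ => 1) * (1 - PowerSeries.X ^ D) = (geomQuot D a : PowerSeries ℚ) := by
  have h1 := congrArg (fun p : Polynomial ℚ => (p : PowerSeries ℚ)) (geomQuot_mul_sub_one h)
  simp only [Polynomial.coe_mul, Polynomial.coe_sub, Polynomial.coe_pow, Polynomial.coe_X,
    Polynomial.coe_one] at h1
  have h2 := dilatedSeries_one_mul ha
  linear_combination (geomQuot D a : PowerSeries ℚ) * h2 + dilatedSeries a (fun _ => 1) * h1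

theorem mk_numParts_mul_eq_numPartsNumerator {A : Finset ℕ} {D : ℕ} (hpos : ∀ a ∈ A, 0 < a)
    (hdvd : ∀ a ∈ A, a ∣ D) :
    (PowerSeries.mk fun n => (numParts (A : Set ℕ) n : ℚ)) *
      (1 - PowerSeries.X ^ D) ^ (A.card + 1) = (numPartsNumerator A D : PowerSeries ℚ) := by
  have hF : (PowerSeries.mk fun n => (numParts (A : Set ℕ) n : ℚ)) =
      (∑ a ∈ A, PowerSeries.X ^ a * dilatedSeries a (fun _ => 1)) *
        ∏ b ∈ A, dilatedSeries b (fun _ => 1) := by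
    rw [mk_numParts_eq hpos, Finset.sum_mul]
    refine Finset.sum_congr rfl fun a ha => ?_
    have h1 : ∏ b ∈ A, dilatedSeries b (fun c => if b = a then (c : ℚ) + 1 else 1) =
        dilatedSeries a (fun _ => 1) * ∏ b ∈ A, dilatedSeries b fun _ => 1 := by
      rw [← Finset.mul_prod_erase A _ ha, ← Finset.mul_prod_erase A _ ha, ← mul_assoc,
        ← dilatedSeries_succ (hpos a ha).ne']
      congr 1
      · simp
      · refine Finset.prod_congr rfl fun b hb => ?_
        simp [Finset.ne_of_mem_erase hb]
    rw [h1]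
    -- This is 1/(1 - x^a) - 1 = x^a/(1 - x^a), times the common product.
    linear_combination (∏ b ∈ A, dilatedSeries b fun _ => 1) *
      dilatedSeries_one_mul (hpos a ha).ne'
  have hcoe : (numPartsNumerator A D : PowerSeries ℚ) =
      (∑ a ∈ A, PowerSeries.X ^ a * (geomQuot D a : PowerSeries ℚ)) *
        ∏ b ∈ A, (geomQuot D b : PowerSeries ℚ) := by
    simp only [← Polynomial.coeToPowerSeries.ringHom_apply, numPartsNumerator, map_mul, map_sum,
      map_prod, map_pow]
    simp
  have hprod : ∏ b ∈ A, (geomQuot D b : PowerSeries ℚ) =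
      (∏ b ∈ A, dilatedSeries b fun _ => 1) * (1 - PowerSeries.X ^ D) ^ A.card := by
    rw [← Finset.prod_const, ← Finset.prod_mul_distrib]
    exact Finset.prod_congr rfl fun b hb =>
      (dilatedSeries_one_mul_eq_geomQuot (hpos b hb).ne' (hdvd b hb)).symm
  have hsum : ∑ a ∈ A, PowerSeries.X ^ a * (geomQuot D a : PowerSeries ℚ) =
      (∑ a ∈ A, PowerSeries.X ^ a * dilatedSeries a (fun _ => 1)) * (1 - PowerSeries.X ^ D) := by
    rw [Finset.sum_mul]
    exact Finset.sum_congr rfl fun b hb => by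
      rw [← dilatedSeries_one_mul_eq_geomQuot (hpos b hb).ne' (hdvd b hb), mul_assoc]
  rw [hcoe, hprod, hsum, hF]
  ring

/-! ### Quasi-polynomial coefficients -/

theorem coeff_eq_sum_choose_of_mul_one_sub_pow {F : PowerSeries ℚ} {N : Polynomial ℚ}
    {D k K l r : ℕ} (hk : 0 < k) (hr : r < D) (hF : F * (1 - PowerSeries.X ^ D) ^ (k + 1) = (N : PowerSeries ℚ))
    (hN : N.natDegree < K) :
    PowerSeries.coeff (D * l + r) F =
      ∑ i ∈ Finset.range K,
        if i % D = r then N.coeff i * ((l + k - i / D).choose k : ℚ) else 0 := by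
  have hD : D ≠ 0 := by omega
  have hF' : F = (N : PowerSeries ℚ) * dilatedSeries D (fun n => ((k + n).choose k : ℚ)) := by
    rw [← hF, mul_assoc, mul_comm (_ ^ _), dilatedSeries_mul_one_sub_pow hD, mul_one]
  have hl : (D * l + r) / D = l := by
    rw [Nat.mul_add_div (by omega), Nat.div_eq_of_lt hr, add_zero]
  rw [hF', PowerSeries.coeff_mul,
    Finset.Nat.sum_antidiagonal_eq_sum_range_succ_mk]
  have hterm : ∀ i ∈ Finset.range (D * l + r).succ,
      PowerSeries.coeff i (N : PowerSeries ℚ) * PowerSeries.coeff (D * l + r - i)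
        (dilatedSeries D (fun n => ((k + n).choose k : ℚ))) =
      if i % D = r then N.coeff i * ((l + k - i / D).choose k : ℚ) else 0 := by
    intro i hi
    have hi' : i ≤ D * l + r := Nat.lt_succ_iff.1 (Finset.mem_range.1 hi)
    rw [Polynomial.coeff_coe, dilatedSeries, PowerSeries.coeff_mk]
    have hiff : D ∣ D * l + r - i ↔ i % D = r := by
      rw [← Nat.modEq_iff_dvd' hi', Nat.ModEq, Nat.mul_add_mod, Nat.mod_eq_of_lt hr]
    rw [if_congr hiff rfl rfl]
    split_ifs with h
    · have h1 : D * l + r - i = D * (l - i / D) := by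
        have := Nat.div_add_mod i D
        rw [Nat.mul_sub]; omega
      have h2 : i / D ≤ l := by rw [← hl]; exact Nat.div_le_div_right hi'
      rw [h1, Nat.mul_div_cancel_left _ (by omega), show k + (l - i / D) = l + k - i / D by omega]
    · rw [mul_zero]
  rw [Finset.sum_congr rfl hterm]
  have hzero1 : ∀ i, K ≤ i →
      (if i % D = r then N.coeff i * ((l + k - i / D).choose k : ℚ) else 0) = 0 := by
    intro i hi
    rw [Polynomial.coeff_eq_zero_of_natDegree_lt (hN.trans_le hi), zero_mul, ite_self]
  have hzero2 : ∀ i, (D * l + r).succ ≤ i →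
      (if i % D = r then N.coeff i * ((l + k - i / D).choose k : ℚ) else 0) = 0 := by
    intro i hi
    split_ifs with h
    · have h1 : l < i / D := by
        by_contra hcon
        have := Nat.div_add_mod i D
        have := Nat.mul_le_mul_left D (not_lt.1 hcon)
        omega
      -- Here k > 0 matters: the top entry stays below k even if the subtraction truncates to 0.
      rw [Nat.choose_eq_zero_of_lt (by omega), Nat.cast_zero, mul_zero]
    · rfl
  rcases le_total K (D * l + r).succ with h | h
  · refine (Finset.sum_subset (Finset.range_mono h) fun i _ hi => hzero1 i ?_).symm
    simpa using hi
  · refine Finset.sum_subset (Finset.range_mono h) fun i _ hi => hzero2 i ?_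
    simpa using hi

open Polynomial in
/-- The polynomial taking the value `(n + m).choose k` at `n`. -/
noncomputable def shiftedChoosePoly (k m : ℕ) : ℚ[X] :=
  C ((k.factorial : ℚ)⁻¹) * (descPochhammer ℚ k).comp (X + C (m : ℚ))

open Polynomial in
theorem eval_shiftedChoosePoly (k m n : ℕ) :
    (shiftedChoosePoly k m).eval (n : ℚ) = ((n + m).choose k : ℚ) := by
  have h : (k.factorial : ℚ) ≠ 0 := Nat.cast_ne_zero.2 (Nat.factorial_ne_zero k)
  rw [shiftedChoosePoly, eval_mul, eval_C, eval_comp, eval_add, eval_X, eval_C, ← Nat.cast_add,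
    descPochhammer_eval_eq_descFactorial, Nat.descFactorial_eq_factorial_mul_choose]
  push_cast
  field_simp

open Polynomial in
theorem natDegree_shiftedChoosePoly_le (k m : ℕ) : (shiftedChoosePoly k m).natDegree ≤ k := by
  refine (natDegree_C_mul_le _ _).trans ?_
  rw [natDegree_comp, natDegree_X_add_C, mul_one, descPochhammer_natDegree]

open Polynomial in
theorem coeff_shiftedChoosePoly (k m : ℕ) :
    (shiftedChoosePoly k m).coeff k = (k.factorial : ℚ)⁻¹ := by
  have h : ((descPochhammer ℚ k).comp (X + C (m : ℚ))).Monic :=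
    (monic_descPochhammer ℚ k).comp_X_add_C _
  have hd : ((descPochhammer ℚ k).comp (X + C (m : ℚ))).natDegree = k := by
    rw [natDegree_comp, natDegree_X_add_C, mul_one, descPochhammer_natDegree]
  have := h.coeff_natDegree
  rw [hd] at this
  rw [shiftedChoosePoly, coeff_C_mul, this, mul_one]

theorem exists_quasiPolynomial_of_mul_one_sub_pow {F : PowerSeries ℚ} {N : Polynomial ℚ}
    {D k r : ℕ} (hk : 0 < k) (hr : r < D) (hF : F * (1 - PowerSeries.X ^ D) ^ (k + 1) = (N : PowerSeries ℚ))
    (hN : N.natDegree < D * (k + 1)) (hne : residueSum D r N ≠ 0) :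
    ∃ q : Polynomial ℚ, q.natDegree = k ∧ q.leadingCoeff = residueSum D r N / k.factorial ∧
      ∀ l : ℕ, PowerSeries.coeff (D * l + r) F = q.eval (l : ℚ) := by
  set q : Polynomial ℚ := ∑ i ∈ Finset.range (D * (k + 1)),
    if i % D = r then Polynomial.C (N.coeff i) * shiftedChoosePoly k (k - i / D) else 0 with hq
  have hcoeff : q.coeff k = residueSum D r N / k.factorial := by
    rw [hq, Polynomial.finsetSum_coeff, residueSum_eq_sum_range hN, Finset.sum_div]
    refine Finset.sum_congr rfl fun i _ => ?_
    split_ifs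
    · rw [Polynomial.coeff_C_mul, coeff_shiftedChoosePoly, div_eq_mul_inv]
    · simp
  have hle : q.natDegree ≤ k := by
    refine Polynomial.natDegree_sum_le_of_forall_le _ _ fun i _ => ?_
    split_ifs
    · exact (Polynomial.natDegree_C_mul_le _ _).trans (natDegree_shiftedChoosePoly_le _ _)
    · simp
  have hdeg : q.natDegree = k := by
    refine Polynomial.natDegree_eq_of_le_of_coeff_ne_zero hle ?_
    rw [hcoeff]
    exact div_ne_zero hne (Nat.cast_ne_zero.2 (Nat.factorial_ne_zero k))
  refine ⟨q, hdeg, by rw [Polynomial.leadingCoeff, hdeg, hcoeff], fun l => ?_⟩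
  rw [coeff_eq_sum_choose_of_mul_one_sub_pow hk hr hF hN, hq, Polynomial.eval_finsetSum]
  refine Finset.sum_congr rfl fun i hi => ?_
  -- By the degree bound on `N`, the shift k - i/D never truncates, so the formula holds from l = 0
  -- on.
  have h1 : i / D ≤ k :=
    Nat.lt_succ_iff.1 (Nat.div_lt_of_lt_mul (Finset.mem_range.1 hi))
  split_ifs
  · rw [Polynomial.eval_mul, Polynomial.eval_C, eval_shiftedChoosePoly, Nat.add_sub_assoc h1]
  · simp

theorem exists_quasiPolynomial_numParts {A : Finset ℕ} (hpos : ∀ a ∈ A, 0 < a)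
    (hgcd : A.gcd id = 1) {r : ℕ} (hr : r < ∏ a ∈ A, a) :
    ∃ q : Polynomial ℚ, q.natDegree = A.card ∧
      q.leadingCoeff = ((∑ a ∈ A, 1 / (a : ℚ)) * ∏ b ∈ A, ((∏ a ∈ A, a : ℕ) : ℚ) / b) /
        A.card.factorial ∧
      ∀ l : ℕ, (numParts (A : Set ℕ) ((∏ a ∈ A, a) * l + r) : ℚ) = q.eval (l : ℚ) := by
  have hA : A.Nonempty := by
    rw [Finset.nonempty_iff_ne_empty]
    rintro rfl
    simp at hgcd
  have hdvd : ∀ a ∈ A, a ∣ ∏ a ∈ A, a := fun a ha => Finset.dvd_prod_of_mem _ ha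
  have hD : 0 < ∏ a ∈ A, a := by omega
  have hres := residueSum_numPartsNumerator hr hpos hdvd hgcd
  have hne : residueSum (∏ a ∈ A, a) r (numPartsNumerator A (∏ a ∈ A, a)) ≠ 0 := by
    rw [hres]
    refine (mul_pos (Finset.sum_pos (fun a ha => ?_) hA) (Finset.prod_pos fun a ha => ?_)).ne'
    · have : (0 : ℚ) < a := Nat.cast_pos.2 (hpos a ha)
      positivity
    · exact div_pos (Nat.cast_pos.2 hD) (Nat.cast_pos.2 (hpos a ha))
  obtain ⟨q, h1, h2, h3⟩ := exists_quasiPolynomial_of_mul_one_sub_pow (Finset.card_pos.2 hA) hr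
    (mk_numParts_mul_eq_numPartsNumerator hpos hdvd)
    (natDegree_numPartsNumerator_lt hD hpos hdvd hA) hne
  refine ⟨q, h1, by rw [h2, hres], fun l => ?_⟩
  rw [← h3, PowerSeries.coeff_mk]

/-- Integer exponents are needed because k - 2 = -1 when `A` is a singleton. -/
theorem leadingCoeff_eq_sum_zpow {A : Finset ℕ} (hpos : ∀ a ∈ A, 0 < a) :
    (∑ a ∈ A, 1 / (a : ℚ)) * ∏ b ∈ A, ((∏ a ∈ A, a : ℕ) : ℚ) / b =
      ∑ a ∈ A, (a : ℚ) ^ ((A.card : ℤ) - 2) * ∏ b ∈ A.erase a, (b : ℚ) ^ ((A.card : ℤ) - 1) := by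
  have hne : ∀ a ∈ A, (a : ℚ) ≠ 0 := fun a ha => Nat.cast_ne_zero.2 (hpos a ha).ne'
  have hD : ((∏ a ∈ A, a : ℕ) : ℚ) ≠ 0 := by
    rw [Nat.cast_prod]; exact Finset.prod_ne_zero_iff.2 hne
  have hprod : ∏ b ∈ A, ((∏ a ∈ A, a : ℕ) : ℚ) / b = ∏ b ∈ A, (b : ℚ) ^ ((A.card : ℤ) - 1) := by
    rw [Finset.prod_div_distrib, Finset.prod_const, Finset.prod_zpow, ← Nat.cast_prod,
      zpow_sub_one₀ hD, zpow_natCast, div_eq_mul_inv]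
  rw [hprod, Finset.sum_mul]
  refine Finset.sum_congr rfl fun a ha => ?_
  rw [← Finset.mul_prod_erase A _ ha, ← mul_assoc]
  congr 1
  rw [show (A.card : ℤ) - 2 = A.card - 1 - 1 by ring, zpow_sub_one₀ (hne a ha) (_ - 1)]
  ring

/-! ### Asymptotics, glued from residue classes -/

theorem tendsto_of_forall_residue {α : Type*} {F : Filter α} {u : ℕ → α} {D : ℕ} (hD : 0 < D)
    (h : ∀ r < D, Filter.Tendsto (fun l => u (D * l + r)) Filter.atTop F) :
    Filter.Tendsto u Filter.atTop F := by
  intro S hS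
  have h1 : ∀ᶠ l in Filter.atTop, ∀ r ∈ Finset.range D, u (D * l + r) ∈ S :=
    (Filter.eventually_all_finset _).2 fun r hr => h r (Finset.mem_range.1 hr) hS
  rw [Filter.mem_map]
  filter_upwards [(Nat.tendsto_div_const_atTop hD.ne').eventually h1] with n hn
  have := hn (n % D) (Finset.mem_range.2 (Nat.mod_lt _ hD))
  rwa [Nat.div_add_mod] at this

theorem isEquivalent_of_forall_residue {u v : ℕ → ℝ} {D : ℕ} (hD : 0 < D)
    (hv : ∀ᶠ n in Filter.atTop, v n ≠ 0)
    (h : ∀ r < D, Asymptotics.IsEquivalent Filter.atTop (fun l => u (D * l + r))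
      (fun l => v (D * l + r))) :
    Asymptotics.IsEquivalent Filter.atTop u v := by
  rw [Asymptotics.isEquivalent_iff_tendsto_one hv]
  refine tendsto_of_forall_residue hD fun r hr => ?_
  have ht : Filter.Tendsto (fun l => D * l + r) Filter.atTop Filter.atTop :=
    Filter.tendsto_atTop_mono (fun l => (Nat.le_mul_of_pos_left l hD).trans (Nat.le_add_right _ r))
      Filter.tendsto_id
  exact (Asymptotics.isEquivalent_iff_tendsto_one (ht.eventually hv)).1 (h r hr)

theorem isEquivalent_mul_add_natCast {D : ℕ} (hD : 0 < D) (r : ℕ) :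
    Asymptotics.IsEquivalent Filter.atTop (fun l : ℕ => ((D * l + r : ℕ) : ℝ))
      (fun l : ℕ => (D : ℝ) * l) := by
  have h : Filter.Tendsto (fun l : ℕ => (D : ℝ) * l) Filter.atTop Filter.atTop :=
    tendsto_natCast_atTop_atTop.const_mul_atTop (Nat.cast_pos.2 hD)
  have := (Asymptotics.IsEquivalent.refl (u := fun l : ℕ => (D : ℝ) * l)
    (l := Filter.atTop)).add_isLittleO ((Asymptotics.isLittleO_const_left (c := (r : ℝ))).2
      (Or.inr (tendsto_norm_atTop_atTop.comp h)))
  simpa using! this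

theorem isEquivalent_eval_natCast (q : Polynomial ℚ) :
    Asymptotics.IsEquivalent Filter.atTop (fun l : ℕ => ((q.eval (l : ℚ) : ℚ) : ℝ))
      (fun l : ℕ => (q.leadingCoeff : ℝ) * (l : ℝ) ^ q.natDegree) := by
  have h := (Polynomial.isEquivalent_atTop_lead (q.map (algebraMap ℚ ℝ))).comp_tendsto
    (tendsto_natCast_atTop_atTop (R := ℝ))
  rw [Polynomial.leadingCoeff_map, Polynomial.natDegree_map] at h
  have heval : (fun l : ℕ => ((q.eval (l : ℚ) : ℚ) : ℝ)) =
      (fun x => (q.map (algebraMap ℚ ℝ)).eval x) ∘ Nat.cast := by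
    funext l
    rw [Function.comp_apply, ← map_natCast (algebraMap ℚ ℝ), Polynomial.eval_map_apply]
    rfl
  rw [heval]
  exact h

theorem isEquivalent_numParts {A : Finset ℕ} (hpos : ∀ a ∈ A, 0 < a) (hgcd : A.gcd id = 1) :
    Asymptotics.IsEquivalent Filter.atTop
      (fun n : ℕ => (numParts (A : Set ℕ) n : ℝ))
      (fun n : ℕ =>
        1 / (A.card.factorial : ℝ) * ((∑ a ∈ A, 1 / (a : ℝ)) / ∏ a ∈ A, (a : ℝ))
          * (n : ℝ) ^ A.card) := by
  have hA : A.Nonempty := by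
    rw [Finset.nonempty_iff_ne_empty]
    rintro rfl
    simp at hgcd
  have hposR : ∀ a ∈ A, (0 : ℝ) < a := fun a ha => Nat.cast_pos.2 (hpos a ha)
  have hD : 0 < ∏ a ∈ A, a := Finset.prod_pos hpos
  have hs : 0 < ∑ a ∈ A, 1 / (a : ℝ) :=
    Finset.sum_pos (fun a ha => one_div_pos.2 (hposR a ha)) hA
  have hp : 0 < ∏ a ∈ A, (a : ℝ) := Finset.prod_pos hposR
  refine isEquivalent_of_forall_residue hD ?_ fun r hr => ?_
  · filter_upwards [Filter.eventually_gt_atTop 0] with n hn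
    have : (0 : ℝ) < n := Nat.cast_pos.2 hn
    positivity
  obtain ⟨q, h1, h2, h3⟩ := exists_quasiPolynomial_numParts hpos hgcd hr
  have hu : (fun l : ℕ => (numParts (A : Set ℕ) ((∏ a ∈ A, a) * l + r) : ℝ)) =
      fun l : ℕ => ((q.eval (l : ℚ) : ℚ) : ℝ) := by
    funext l
    rw [← h3, Rat.cast_natCast]
  rw [hu]
  refine (isEquivalent_eval_natCast q).trans ?_
  have hv := ((Asymptotics.IsEquivalent.refl (u := fun _ : ℕ => 1 / (A.card.factorial : ℝ) *
    ((∑ a ∈ A, 1 / (a : ℝ)) / ∏ a ∈ A, (a : ℝ))) (l := Filter.atTop)).mul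
      ((isEquivalent_mul_add_natCast hD r).pow A.card)).symm
  convert! hv using 1
  funext l
  rw [h1, h2]
  simp only [Pi.mul_apply, Pi.pow_apply]
  rw [mul_pow, Finset.prod_div_distrib, Finset.prod_const]
  push_cast
  field_simp

theorem mainTheorem2 (A : Finset ℕ) (hpos : ∀ a ∈ A, 0 < a) (hgcd : A.gcd id = 1) :
    Asymptotics.IsEquivalent Filter.atTop
      (fun n : ℕ => (numParts (A : Set ℕ) n : ℝ))
      (fun n : ℕ =>
        1 / (A.card.factorial : ℝ) * ((∑ a ∈ A, 1 / (a : ℝ)) / ∏ a ∈ A, (a : ℝ))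
          * (n : ℝ) ^ A.card) ∧
    ∀ r : ℕ, r < ∏ a ∈ A, a →
      ∃ q : Polynomial ℚ,
        q.natDegree = A.card ∧
        q.leadingCoeff =
          (∑ a ∈ A, (a : ℚ) ^ ((A.card : ℤ) - 2) *
            ∏ b ∈ A.erase a, (b : ℚ) ^ ((A.card : ℤ) - 1)) / (A.card.factorial : ℚ) ∧
        ∀ l : ℕ, (numParts (A : Set ℕ) ((∏ a ∈ A, a) * l + r) : ℚ) = q.eval (l : ℚ) := by
  refine ⟨isEquivalent_numParts hpos hgcd, fun r hr => ?_⟩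
  rw [← leadingCoeff_eq_sum_zpow hpos]
  exact exists_quasiPolynomial_numParts hpos hgcd hr
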